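/- For a finite group $G$ let $\psi(G)=\sum_{g\in G} o(g)$, where $o(g)$ is the order of $g$, and let $C_n$ denote the cyclic group of order $n$. A group $G$ is supersolvable if it has a finite series $1=H_0\le H_1\le\dots\le H_k=G$ of subgroups normal in $G$ with every factor $H_{i+1}/H_i$ cyclic. **Theorem.** Let $G$ be a finite non-supersolvable group of order $n$ such that $\psi(G)=\frac{31}{77}\,\psi(C_n)$. Then $G\cong A_4\times C_m$ for some positive integer $m$ with $\gcd(6,m)=1$. -/

import Mathlib

/-- The sum `ψ(G)` of the element orders of a finite group `G`. -/
noncomputable def sumOrders (G : Type*) [Group G] [Fintype G] : ℕ :=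
  ∑ g : G, orderOf g

/-- A group `G` is supersolvable if it has a finite series `1 = H₀ ≤ H₁ ≤ ⋯ ≤ H_k = G` of
subgroups that are all normal in `G`, with every factor `H_{i+1} / H_i` cyclic. -/
def IsSupersolvable (G : Type*) [Group G] : Prop :=
  ∃ (k : ℕ) (H : Fin (k + 1) → Subgroup G) (_ : ∀ i, (H i).Normal),
    H 0 = ⊥ ∧ H (Fin.last k) = ⊤ ∧
    ∀ i : Fin k, H i.castSucc ≤ H i.succ ∧
      IsCyclic (H i.succ ⧸ (H i.castSucc).subgroupOf (H i.succ))

/-- The cyclic group `C_n` of order `n` (for `n ≥ 1`), written multiplicatively. -/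
abbrev CyclicGroupOfOrder (n : ℕ) : Type :=
  Multiplicative (ZMod n)

/-! Write ψ(n) for ψ(C_n). A large ψ(G) forces an element of large order. If x has maximal order,
then ψ(G) ≤ n·o(x), while the product formula for ψ(n) telescopes to ψ(n) ≥ 5n²/(2(N+1)) when no
prime factor of n exceeds N ≥ 4. So ψ(G) ≥ (31/77)ψ(n) gives ⟨x⟩ index at most (154/155)(N+1), hence
at most N (`exists_index_zpowers_le`). Prime index makes G supersolvable.

Suppose N > 4 is the largest prime divisor of n. An index below N yields a cyclic normal Sylow
N-subgroup P. Then ψ(G) ≤ ψ(P)ψ(G/P), so the inequality passes to G/P and induction applies. If G/P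
≅ A₄ × C_m, its ratio is exactly 31/77. Equality then holds throughout, which makes P central, and P
splits off as a direct factor.

If only 2 and 3 divide n, the remaining nontrivial index is 4. The action on cosets maps G to S₄
with cyclic kernel K. Either the image is a 2-group and G is supersolvable, or it is A₄ and K is
central; counting orders over A₄ then forces K = 1. -/

/-! ### Sums of element orders in cyclic groups. -/

/-- The value `∑ d ∣ n, d φ(d)` of the sum of element orders on a cyclic group of order `n`. -/
def cyclicOrdSum (n : ℕ) : ℕ := ∑ d ∈ n.divisors, d * d.totient

theorem sumOrders_eq_of_isCyclic {G : Type*} [Group G] [Fintype G] [IsCyclic G] :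
    sumOrders G = cyclicOrdSum (Nat.card G) := by
  classical
  rw [sumOrders, cyclicOrdSum, Nat.card_eq_fintype_card,
    ← Finset.sum_fiberwise_of_maps_to (s := Finset.univ) (t := (Fintype.card G).divisors)
      (g := fun g : G => orderOf g)
      (fun g _ => Nat.mem_divisors.2 ⟨orderOf_dvd_card, Fintype.card_ne_zero⟩)]
  refine Finset.sum_congr rfl fun d hd => ?_
  rw [Finset.sum_congr rfl (g := fun _ => d) (fun g hg => (Finset.mem_filter.1 hg).2),
    Finset.sum_const, smul_eq_mul, mul_comm]
  rw [IsCyclic.card_orderOf_eq_totient (by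
    simpa using Nat.dvd_of_mem_divisors hd)]

theorem cyclicOrdSum_mul {m n : ℕ} (h : m.Coprime n) :
    cyclicOrdSum (m * n) = cyclicOrdSum m * cyclicOrdSum n := by
  rw [cyclicOrdSum, cyclicOrdSum, cyclicOrdSum, Finset.sum_mul_sum, ← Finset.sum_product',
    Nat.divisors_mul, Finset.mul_def, Finset.sum_image h.mul_injOn_divisors]
  refine Finset.sum_congr rfl fun x hx => ?_
  rw [Finset.mem_product, Nat.mem_divisors, Nat.mem_divisors] at hx
  rw [Nat.totient_mul ((h.coprime_dvd_left hx.1.1).coprime_dvd_right hx.2.1)]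
  ring

theorem cyclicOrdSum_one : cyclicOrdSum 1 = 1 := by simp [cyclicOrdSum]

theorem cyclicOrdSum_prime_pow {p : ℕ} (hp : p.Prime) (k : ℕ) :
    (p + 1) * cyclicOrdSum (p ^ k) = p * (p ^ k) ^ 2 + 1 := by
  induction k with
  | zero => simp [cyclicOrdSum]
  | succ k ih =>
    have h : cyclicOrdSum (p ^ (k + 1)) =
        cyclicOrdSum (p ^ k) + p ^ (k + 1) * (p ^ k * (p - 1)) := by
      rw [cyclicOrdSum, cyclicOrdSum, Nat.divisors_prime_pow hp, Nat.divisors_prime_pow hp,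
        Finset.sum_map, Finset.sum_map, Finset.sum_range_succ]
      simp [Nat.totient_prime_pow_succ hp]
    obtain ⟨r, rfl⟩ : ∃ r, p = r + 1 := ⟨p - 1, by have := hp.pos; omega⟩
    rw [h, mul_add, ih, Nat.add_sub_cancel]
    ring

theorem cyclicOrdSum_pos {n : ℕ} (hn : n ≠ 0) : 0 < cyclicOrdSum n :=
  Finset.sum_pos (fun d hd => Nat.mul_pos (Nat.pos_of_mem_divisors hd)
    (Nat.totient_pos.2 (Nat.pos_of_mem_divisors hd))) ⟨1, by simpa using hn⟩

/-- Admitting one more prime `p` worsens a lower bound for `cyclicOrdSum n` by `p / (p + 1)`. -/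
theorem cyclicOrdSum_bound_prime {p A B : ℕ} (hp : p.Prime)
    (h : ∀ n, n ≠ 0 → (∀ r, r.Prime → r ∣ n → r < p) → B * n ^ 2 ≤ A * cyclicOrdSum n)
    (n : ℕ) (hn : n ≠ 0) (hr : ∀ r, r.Prime → r ∣ n → r ≤ p) :
    B * p * n ^ 2 ≤ A * (p + 1) * cyclicOrdSum n := by
  obtain ⟨k, m, hm, rfl⟩ := Nat.exists_eq_pow_mul_and_not_dvd hn p hp.ne_one
  have hm0 : m ≠ 0 := by rintro rfl; simp at hm
  have h1 := h m hm0 fun r hrp hrm => lt_of_le_of_ne (hr r hrp (hrm.mul_left _)) (by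
    rintro rfl; exact hm hrm)
  rw [cyclicOrdSum_mul (((Nat.Prime.coprime_iff_not_dvd hp).2 hm).pow_left k)]
  have h2 := cyclicOrdSum_prime_pow hp k
  calc B * p * (p ^ k * m) ^ 2 = (p * (p ^ k) ^ 2) * (B * m ^ 2) := by ring
    _ ≤ ((p + 1) * cyclicOrdSum (p ^ k)) * (A * cyclicOrdSum m) :=
        Nat.mul_le_mul (by omega) h1
    _ = _ := by ring

/-- The factors p/(p+1) telescope: 2/3 · 3/4 = 1/2 = 5/(2·5) at N = 4, and each later prime N+1
costs (N+1)/(N+2). -/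
theorem cyclicOrdSum_lower_bound (N : ℕ) (hN : 4 ≤ N) (n : ℕ) (hn : n ≠ 0)
    (hr : ∀ r, r.Prime → r ∣ n → r ≤ N) : 5 * n ^ 2 ≤ 2 * (N + 1) * cyclicOrdSum n := by
  induction N, hN using Nat.le_induction generalizing n with
  | base =>
    have h2 : ∀ n, n ≠ 0 → (∀ r, r.Prime → r ∣ n → r ≤ 2) →
        1 * 2 * n ^ 2 ≤ 1 * (2 + 1) * cyclicOrdSum n := by
      refine cyclicOrdSum_bound_prime Nat.prime_two fun n hn hr => ?_
      have : n = 1 := by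
        by_contra h
        obtain ⟨r, hrp, hrn⟩ := Nat.exists_prime_and_dvd h
        exact absurd (hr r hrp hrn) (by have := hrp.two_le; omega)
      simp [this, cyclicOrdSum_one]
    have h3 := cyclicOrdSum_bound_prime Nat.prime_three
      (fun n hn hr => h2 n hn fun r hrp hrn => Nat.le_of_lt_succ (hr r hrp hrn)) n hn
      (fun r hrp hrn => by
        have := hr r hrp hrn
        rcases Nat.lt_or_ge r 4 with h | h
        · omega
        · obtain rfl : r = 4 := by omega
          norm_num at hrp)
    omega
  | succ N hN ih =>
    by_cases hp : (N + 1).Prime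
    · have := cyclicOrdSum_bound_prime (A := 2 * (N + 1)) (B := 5) hp (fun n hn hr =>
        ih n hn fun r hrp hrn => Nat.le_of_lt_succ (hr r hrp hrn)) n hn hr
      refine Nat.le_of_mul_le_mul_left (c := N + 1) ?_ (by omega)
      calc _ = 5 * (N + 1) * n ^ 2 := by ring
        _ ≤ _ := this
        _ = _ := by ring
    -- For composite N+1 the set of admissible primes is unchanged and the claimed bound only
    -- weakens.
    · refine (ih n hn fun r hrp hrn => ?_).trans (by gcongr; omega)
      have := hr r hrp hrn
      exact Nat.le_of_lt_succ (lt_of_le_of_ne this (by rintro rfl; exact hp hrp))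

/-! ### Supersolvability criteria. -/

theorem IsSupersolvable.of_subsingleton (G : Type*) [Group G] [Subsingleton G] :
    IsSupersolvable G :=
  ⟨0, fun _ => ⊥, fun _ => inferInstance, rfl, Subsingleton.elim _ _, fun i => i.elim0⟩

/-- An extension of a supersolvable group by a cyclic normal subgroup is supersolvable. -/
theorem IsSupersolvable.of_quotient {G : Type*} [Group G] (N : Subgroup G) [N.Normal]
    [IsCyclic N] (h : IsSupersolvable (G ⧸ N)) : IsSupersolvable G := by
  obtain ⟨k, H, hH, h0, hl, hs⟩ := h
  let π := QuotientGroup.mk' N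
  let H' : Fin (k + 2) → Subgroup G := Fin.cons ⊥ fun i => (H i).comap π
  have hn : ∀ i, (H' i).Normal := by
    intro i
    refine Fin.cases ?_ (fun i => ?_) i
    · exact Subgroup.normal_bot
    · exact (hH i).comap π
  refine ⟨k + 1, H', hn, rfl, ?_, ?_⟩
  · change (H (Fin.last k)).comap π = ⊤
    rw [hl, Subgroup.comap_top]
  · intro i
    induction i using Fin.cases with
    | zero =>
      refine ⟨bot_le, ?_⟩
      have e : H' (Fin.succ 0) = N := by
        change (H 0).comap π = N
        rw [h0, MonoidHom.comap_bot, QuotientGroup.ker_mk']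
      have : IsCyclic (H' (Fin.succ 0)) := by rw [e]; infer_instance
      exact isCyclic_of_surjective (QuotientGroup.mk' _) (QuotientGroup.mk'_surjective _)
    | succ i =>
      obtain ⟨hle, hc⟩ := hs i
      refine ⟨Subgroup.comap_mono hle, ?_⟩
      let φ : (H i.succ).comap π →* H i.succ ⧸ (H i.castSucc).subgroupOf (H i.succ) :=
        (QuotientGroup.mk' _).comp (π.subgroupComap (H i.succ))
      have hker : φ.ker = ((H i.castSucc).comap π).subgroupOf ((H i.succ).comap π) := by
        ext x
        rw [MonoidHom.mem_ker, MonoidHom.comp_apply, QuotientGroup.mk'_apply,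
          QuotientGroup.eq_one_iff, Subgroup.mem_subgroupOf, Subgroup.mem_subgroupOf]
        rfl
      have hφ : IsCyclic (((H i.succ).comap π) ⧸ φ.ker) :=
        isCyclic_of_injective _ (QuotientGroup.kerLift_injective φ)
      have e := QuotientGroup.quotientMulEquivOfEq hker
      exact isCyclic_of_surjective e e.surjective

theorem IsSupersolvable.of_isCyclic (G : Type*) [Group G] [IsCyclic G] : IsSupersolvable G := by
  have : Subsingleton (G ⧸ (⊤ : Subgroup G)) := QuotientGroup.subsingleton_quotient_top
  exact .of_quotient ⊤ (.of_subsingleton _)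

theorem IsPGroup.isSupersolvable {p : ℕ} [Fact p.Prime] {G : Type*} [Group G] [Finite G]
    (hG : IsPGroup p G) : IsSupersolvable G := by
  induction hn : Nat.card G using Nat.strong_induction_on generalizing G with
  | _ n ih =>
    rcases subsingleton_or_nontrivial G with h | h
    · exact .of_subsingleton G
    have := hG.center_nontrivial
    obtain ⟨⟨z, hz⟩, hz1⟩ := exists_ne (1 : Subgroup.center G)
    have hz1 : z ≠ 1 := fun h => hz1 (Subtype.ext h)
    have hle : Subgroup.zpowers z ≤ Subgroup.center G := by simpa using hz
    have hN : (Subgroup.zpowers z).Normal :=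
    ⟨fun a ha g => by rwa [Subgroup.mem_center_iff.1 (hle ha) g, mul_inv_cancel_right]⟩
    refine .of_quotient (Subgroup.zpowers z) (ih _ ?_ (hG.to_quotient _) rfl)
    have h1 := Subgroup.card_eq_card_quotient_mul_card_subgroup (Subgroup.zpowers z)
    have h2 : 1 < Nat.card (Subgroup.zpowers z) := by
      rw [Nat.card_zpowers]
      have := orderOf_pos z
      have : orderOf z ≠ 1 := by simpa using hz1
      omega
    rw [← hn, h1]
    exact lt_mul_of_one_lt_right Nat.card_pos h2

/-- The Sylow subgroups are normal as soon as one of them has normalizer of index `< p`. -/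
theorem Sylow.normal_of_index_lt {p : ℕ} [Fact p.Prime] {G : Type*} [Group G] [Finite G]
    (P : Sylow p G) {A : Subgroup G} (hA : A ≤ Subgroup.normalizer (P : Set G))
    (h : A.index < p) :
    (P : Subgroup G).Normal := by
  have h0 : A.index ≠ 0 := Subgroup.index_ne_zero_of_finite
  have h1 := Subgroup.index_antitone hA
  have h2 := card_sylow_modEq_one p G
  rw [P.card_eq_index_normalizer, Nat.ModEq, Nat.mod_eq_of_lt (by exact h1.trans_lt h),
    Nat.mod_eq_of_lt (Fact.out : p.Prime).one_lt] at h2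
  exact Subgroup.normalizer_eq_top_iff.1 (Subgroup.index_eq_one.1 h2)

/-- If an abelian subgroup of prime index `p` is not normal, then its image modulo its core has
order at most `p`. -/
theorem Subgroup.relIndex_normalCore_le {G : Type*} [Group G] [Finite G] {p : ℕ} (hp : p.Prime)
    (A : Subgroup G) [IsMulCommutative A] (hA : A.index = p) (hn : ¬ A.Normal) :
    A.normalCore.relIndex A ≤ p := by
  obtain ⟨a, ha, g, hg⟩ : ∃ a ∈ A, ∃ g, g * a * g⁻¹ ∉ A := by
    by_contra! h
    exact hn ⟨h⟩
  let B := A.map (MulAut.conj g).toMonoidHom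
  have hB : B.index = p := by rw [← hA]; exact Subgroup.index_map_equiv A (MulAut.conj g)
  have hgB : g * a * g⁻¹ ∈ B := ⟨a, ha, rfl⟩
  -- An element of A ∩ gAg⁻¹ commutes with A and with gag⁻¹ ∉ A; as A has prime index it is maximal,
  -- so the element is central.
  have hle : B ⊓ A ≤ A.normalCore := by
    rintro z ⟨⟨b, hb, hz⟩, hzA⟩
    have hcA : A ≤ centralizer {z} := fun x hx => mem_centralizer_singleton_iff.2
      (congrArg Subtype.val (mul_comm' (⟨x, hx⟩ : A) ⟨z, hzA⟩))
    have hcB : g * a * g⁻¹ ∈ centralizer {z} := by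
      rw [mem_centralizer_singleton_iff, ← hz]
      have := congrArg Subtype.val (mul_comm' (⟨a, ha⟩ : A) ⟨b, hb⟩)
      change a * b = b * a at this
      change g * a * g⁻¹ * (g * b * g⁻¹) = g * b * g⁻¹ * (g * a * g⁻¹)
      simp only [mul_assoc, inv_mul_cancel_left]
      rw [← mul_assoc a, this, mul_assoc]
    have hi := relIndex_mul_index hcA
    rw [hA] at hi
    have htop : centralizer {z} = ⊤ := by
      rcases (Nat.dvd_prime hp).1 (Dvd.intro _ hi) with h | h
      · exact absurd (relIndex_eq_one.1 h hcB) hg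
      · rw [h] at hi
        exact index_eq_one.1 (Nat.eq_of_mul_eq_mul_left hp.pos (by omega))
    intro y
    have : y ∈ centralizer {z} := htop ▸ mem_top y
    rw [mem_centralizer_singleton_iff] at this
    rwa [this, mul_inv_cancel_right]
  calc A.normalCore.relIndex A ≤ (B ⊓ A).relIndex A :=
        relIndex_le_of_le_left hle (index_ne_zero_of_finite)
    _ = B.relIndex A := inf_relIndex_right _ _
    _ ≤ B.relIndex ⊤ := relIndex_le_of_le_right le_top index_ne_zero_of_finite
    _ = p := by rw [relIndex_top_right, hB]

/-- When A is not normal, factor out its cyclic core. The quotient has order dp with d ≤ p: it is a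
p-group if d = p, and otherwise it has a normal Sylow p-subgroup of order p, modulo which everything
is an image of A. -/
theorem IsSupersolvable.of_isCyclic_of_index_prime {G : Type*} [Group G] [Finite G] {p : ℕ}
    (hp : p.Prime) (A : Subgroup G) [IsCyclic A] (hA : A.index = p) : IsSupersolvable G := by
  have : Fact p.Prime := ⟨hp⟩
  by_cases hn : A.Normal
  · have : IsCyclic (G ⧸ A) := isCyclic_of_prime_card (p := p) hA
    exact .of_quotient A (.of_isCyclic _)
  let K := A.normalCore
  have hKA : K ≤ A := A.normalCore_le
  have : IsCyclic K := isCyclic_of_injective _ (Subgroup.inclusion_injective hKA)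
  refine .of_quotient K ?_
  set d := K.relIndex A with hd
  have hdp : d ≤ p := Subgroup.relIndex_normalCore_le hp A hA hn
  have hd0 : 0 < d := Nat.pos_of_ne_zero Subgroup.index_ne_zero_of_finite
  have hcard : Nat.card (G ⧸ K) = d * p := by
    rw [← hA]; exact (Subgroup.relIndex_mul_index hKA).symm
  rcases hdp.eq_or_lt with h | h
  · exact (IsPGroup.of_card (p := p) (n := 2) (by rw [hcard, h, sq])).isSupersolvable
  have hpd : ¬ p ∣ d := fun h' => absurd (Nat.le_of_dvd hd0 h') (by omega)
  obtain ⟨P⟩ : Nonempty (Sylow p (G ⧸ K)) := inferInstance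
  have hP : Nat.card P = p := by
    rw [P.card_eq_multiplicity, hcard, Nat.factorization_mul hd0.ne' hp.ne_zero]
    simp [Nat.factorization_eq_zero_of_not_dvd hpd, hp.factorization_self]
  have hPi : (P : Subgroup (G ⧸ K)).index = d := by
    have := (P : Subgroup (G ⧸ K)).card_mul_index
    rw [hcard] at this
    change Nat.card P * _ = _ at this
    rw [hP, mul_comm] at this
    exact Nat.eq_of_mul_eq_mul_right hp.pos this
  have hPn : (P : Subgroup (G ⧸ K)).Normal :=
    P.normal_of_index_lt Subgroup.le_normalizer (hPi.trans_lt h)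
  have : IsCyclic (P : Subgroup (G ⧸ K)) := isCyclic_of_prime_card hP
  refine .of_quotient (P : Subgroup (G ⧸ K)) ?_
  let φ : G →* (G ⧸ K) ⧸ (P : Subgroup (G ⧸ K)) :=
    (QuotientGroup.mk' _).comp (QuotientGroup.mk' K)
  have hφ : Function.Surjective φ :=
    (QuotientGroup.mk'_surjective _).comp (QuotientGroup.mk'_surjective _)
  have hi : φ.ker.index = d := by
    rw [Subgroup.index_ker, MonoidHom.range_eq_top.2 hφ, Subgroup.card_top]
    exact hPi
  -- The index of the join divides both p and d, and p does not divide d.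
  have htop : φ.ker ⊔ A = ⊤ := by
    have h1 := Subgroup.relIndex_mul_index (le_sup_right : A ≤ φ.ker ⊔ A)
    rw [hA] at h1
    rcases (Nat.dvd_prime hp).1 (Dvd.intro_left _ h1) with h' | h'
    · exact Subgroup.index_eq_one.1 h'
    · have h2 := Subgroup.index_dvd_of_le (le_sup_left : φ.ker ≤ φ.ker ⊔ A)
      rw [h', hi] at h2
      exact absurd h2 hpd
  have : IsCyclic ((G ⧸ K) ⧸ (P : Subgroup (G ⧸ K))) := by
    refine isCyclic_of_surjective (φ.comp A.subtype) fun y => ?_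
    obtain ⟨g, rfl⟩ := hφ y
    have hg : g ∈ φ.ker ⊔ A := by rw [htop]; exact Subgroup.mem_top g
    obtain ⟨k, hk, a, ha, rfl⟩ := Subgroup.mem_sup_of_normal_left.1 hg
    exact ⟨⟨a, ha⟩, by simp [MonoidHom.mem_ker.1 hk]⟩
  exact .of_isCyclic _

/-! ### Element orders modulo a normal cyclic Sylow subgroup. -/

theorem sum_eq_sum_quotient {G M : Type*} [Group G] [Fintype G] [AddCommMonoid M]
    (N : Subgroup G) [Fintype (G ⧸ N)] [Fintype N] (f : G → M) :
    ∑ g, f g = ∑ q : G ⧸ N, ∑ u : N, f (q.out * u) := by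
  rw [← Fintype.sum_prod_type']
  symm
  refine Fintype.sum_bijective (fun x : (G ⧸ N) × N => x.1.out * (x.2 : G)) ⟨?_, fun g => ?_⟩ _ _
    fun _ => rfl
  · rintro ⟨q, u⟩ ⟨r, v⟩ h
    have h1 : q = r := by simpa using congrArg (QuotientGroup.mk (s := N)) h
    subst h1
    simpa using h
  · obtain ⟨w, hw⟩ := QuotientGroup.mk_out_eq_mul N g
    exact ⟨(g, w⁻¹), by simp [hw]⟩

theorem orderOf_eq_mul_orderOf_pow {G : Type*} [Group G] [Finite G] (N : Subgroup G) [N.Normal]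
    (y : G) : orderOf y = orderOf (y : G ⧸ N) * orderOf (y ^ orderOf (y : G ⧸ N)) := by
  have h : orderOf (y : G ⧸ N) ∣ orderOf y := orderOf_map_dvd (QuotientGroup.mk' N) y
  rw [orderOf_pow_of_dvd (orderOf_pos _).ne' h, Nat.mul_div_cancel' h]

theorem pow_orderOf_mk_mem {G : Type*} [Group G] (N : Subgroup G) [N.Normal] (y : G) :
    y ^ orderOf (y : G ⧸ N) ∈ N := by
  rw [← QuotientGroup.eq_one_iff, QuotientGroup.mk_pow, pow_orderOf_eq_one]

theorem mk_mul_coe {G : Type*} [Group G] (N : Subgroup G) [N.Normal] (x : G) (u : N) :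
    ((x * u : G) : G ⧸ N) = x := by simp

/-- Here (xu)^m = x^m u^m, and u ↦ x^m u^m permutes P because m is coprime to |P|. -/
theorem sum_orderOf_coset_of_commute {G : Type*} [Group G] [Finite G] (P : Subgroup G)
    [P.Normal] [Fintype P] [IsMulCommutative P] (hcop : (Nat.card P).Coprime P.index)
    (x : G) (hx : ∀ u ∈ P, Commute x u) :
    ∑ u : P, orderOf (x * u) = sumOrders P * orderOf (x : G ⧸ P) := by
  set m := orderOf (x : G ⧸ P) with hm
  have hmP : (Nat.card P).Coprime m := hcop.coprime_dvd_right (orderOf_dvd_natCard _)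
  have hc : ∀ u : P, orderOf (x * u) =
      orderOf (⟨x ^ m, pow_orderOf_mk_mem P x⟩ * u ^ m : P) * m := by
    intro u
    rw [orderOf_eq_mul_orderOf_pow P, mk_mul_coe, ← hm, mul_comm, (hx u u.2).mul_pow,
      ← Subgroup.orderOf_coe]
    rfl
  rw [sumOrders, Finset.sum_mul, Finset.sum_congr rfl fun u _ => hc u]
  exact Equiv.sum_comp ((powCoprime hmP).trans (Equiv.mulLeft _)) fun u : P => orderOf u * m

/-- If x does not centralize P, no (xu)^m generates P: a generator would commute with xu and u,
hence with x. So every order in the coset is at most p^(k-1)·m, and p^(2k-1) < ψ(p^k) makes the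
inequality strict. -/
theorem sum_orderOf_coset_le {G : Type*} [Group G] [Finite G] {p k : ℕ} (hp : p.Prime)
    (P : Subgroup G) [P.Normal] [Fintype P] (hP : IsCyclic P) (hcard : Nat.card P = p ^ k)
    (hcop : (Nat.card P).Coprime P.index) (x : G) :
    ∑ u : P, orderOf (x * u) ≤ cyclicOrdSum (Nat.card P) * orderOf (x : G ⧸ P) ∧
    (∑ u : P, orderOf (x * u) = cyclicOrdSum (Nat.card P) * orderOf (x : G ⧸ P) →
      ∀ u ∈ P, Commute x u) := by
  have : IsMulCommutative P := IsCyclic.isMulCommutative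
  by_cases hx : ∀ u ∈ P, Commute x u
  · rw [sum_orderOf_coset_of_commute P hcop x hx, sumOrders_eq_of_isCyclic]
    exact ⟨le_rfl, fun _ => hx⟩
  suffices h : ∑ u : P, orderOf (x * u) < cyclicOrdSum (Nat.card P) * orderOf (x : G ⧸ P) from
    ⟨h.le, fun h' => absurd h' h.ne⟩
  set m := orderOf (x : G ⧸ P) with hm
  have hu : ∀ u : P, p * orderOf (x * u) ≤ p ^ k * m := by
    intro u
    rw [orderOf_eq_mul_orderOf_pow P, mk_mul_coe, ← hm]
    set v : P := ⟨(x * u) ^ m, by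
      have := pow_orderOf_mk_mem P (x * u); rwa [mk_mul_coe, ← hm] at this⟩ with hv
    have hvx : (x * u) ^ m = (v : G) := rfl
    rw [hvx, Subgroup.orderOf_coe]
    have hvd : orderOf v ∣ p ^ k := hcard ▸ orderOf_dvd_natCard v
    have hne : orderOf v ≠ p ^ k := by
      intro h
      apply hx
      have hz : ∀ w : P, w ∈ Subgroup.zpowers v :=
        by
          have : Subgroup.zpowers v = ⊤ :=
            Subgroup.eq_top_of_card_eq _ (by rw [Nat.card_zpowers, h, hcard])
          intro w; rw [this]; exact Subgroup.mem_top w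
      intro w hw
      have hvu : Commute x (v : G) := by
        have h1 : Commute (x * u) (v : G) := by rw [← hvx]; exact Commute.self_pow _ _
        have h2 : Commute ((u : G)⁻¹) (v : G) :=
          congrArg Subtype.val (mul_comm' (u⁻¹) v)
        have := h1.mul_left h2
        rwa [mul_inv_cancel_right] at this
      obtain ⟨z, hz⟩ := hz ⟨w, hw⟩
      have : w = (v : G) ^ z := by
        have := congrArg Subtype.val hz
        simpa using this.symm
      rw [this]
      exact hvu.zpow_right z
    have hdvd : p * orderOf v ∣ p ^ k := by
      obtain ⟨j, hj, hvj⟩ := (Nat.dvd_prime_pow hp).1 hvd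
      have : j < k := lt_of_le_of_ne hj (by rintro rfl; exact hne hvj)
      rw [hvj, ← pow_succ']
      exact pow_dvd_pow p this
    have := Nat.le_of_dvd (pow_pos hp.pos k) hdvd
    calc _ = p * orderOf v * m := by ring
      _ ≤ _ := Nat.mul_le_mul_right _ this
  have hm0 : 0 < m := orderOf_pos _
  have h1 : p * ∑ u : P, orderOf (x * u) ≤ p ^ k * (p ^ k * m) := by
    rw [Finset.mul_sum]
    refine (Finset.sum_le_card_nsmul _ _ _ fun u _ => hu u).trans ?_
    rw [Finset.card_univ, ← Nat.card_eq_fintype_card, hcard, smul_eq_mul]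
  have h2 := cyclicOrdSum_prime_pow hp k
  have h3 : p ^ k * p ^ k < p * cyclicOrdSum (p ^ k) := by
    have := hp.two_le
    nlinarith [sq_nonneg (p ^ k), Nat.mul_le_mul_right (p ^ k * p ^ k) (show p + 1 ≤ p * p by nlinarith)]
  rw [hcard]
  refine lt_of_mul_lt_mul_left (a := p) ?_ (Nat.zero_le _)
  calc _ ≤ p ^ k * (p ^ k * m) := h1
    _ = p ^ k * p ^ k * m := by ring
    _ < p * cyclicOrdSum (p ^ k) * m := Nat.mul_lt_mul_of_pos_right h3 hm0
    _ = _ := by ring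

/-- A cyclic normal Sylow subgroup `P` gives `ψ(G) ≤ ψ(P) ψ(G ⧸ P)`, with equality only if `P` is
central. -/
theorem sumOrders_le_mul_sumOrders_quotient {G : Type*} [Group G] [Fintype G] {p k : ℕ}
    (hp : p.Prime) (P : Subgroup G) [P.Normal] [Fintype (G ⧸ P)] (hP : IsCyclic P)
    (hcard : Nat.card P = p ^ k) (hcop : (Nat.card P).Coprime P.index) :
    sumOrders G ≤ cyclicOrdSum (Nat.card P) * sumOrders (G ⧸ P) ∧
    (sumOrders G = cyclicOrdSum (Nat.card P) * sumOrders (G ⧸ P) → P ≤ Subgroup.center G) := by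
  have := Fintype.ofFinite P
  have hle : ∀ q ∈ (Finset.univ : Finset (G ⧸ P)), ∑ u : P, orderOf (q.out * u) ≤
      cyclicOrdSum (Nat.card P) * orderOf q := fun q _ => by
    simpa using (sum_orderOf_coset_le hp P hP hcard hcop q.out).1
  rw [sumOrders, sumOrders, sum_eq_sum_quotient P, Finset.mul_sum]
  refine ⟨Finset.sum_le_sum hle, fun h u hu => Subgroup.mem_center_iff.2 fun g => ?_⟩
  have h1 := (Finset.sum_eq_sum_iff_of_le hle).1 h (g : G ⧸ P) (Finset.mem_univ _)
  have h2 := (sum_orderOf_coset_le hp P hP hcard hcop (g : G ⧸ P).out).2 (by simpa using h1)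
  -- The chosen representative differs from g by w ∈ P, which commutes with P.
  obtain ⟨w, hw⟩ := QuotientGroup.mk_out_eq_mul P g
  have h3 := h2 u hu
  rw [hw] at h3
  have h4 : Commute ((w : G)⁻¹) u := by
    have : IsMulCommutative P := IsCyclic.isMulCommutative
    exact congrArg Subtype.val (mul_comm' w⁻¹ ⟨u, hu⟩)
  have := h3.mul_left h4
  rwa [mul_inv_cancel_right] at this

/-- A central subgroup of coprime index is a direct factor. -/
theorem nonempty_mulEquiv_prod_of_le_center {G : Type*} [Group G] [Finite G] (P : Subgroup G)
    [P.Normal] (hP : P ≤ Subgroup.center G) (hcop : (Nat.card P).Coprime P.index) :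
    Nonempty (G ≃* (G ⧸ P) × P) := by
  obtain ⟨H, hH⟩ := Subgroup.exists_right_complement'_of_coprime hcop
  let f : H × P →* G := MonoidHom.noncommCoprod H.subtype P.subtype fun h u =>
    Subgroup.mem_center_iff.1 (hP u.2) h
  have hf : Function.Bijective f := hH.symm
  exact ⟨(MulEquiv.ofBijective f hf).symm.trans
    (hH.symm.QuotientMulEquiv.symm.prodCongr (MulEquiv.refl _))⟩

/-! ### Cyclic subgroups of index four and the action on their cosets. -/

theorem perm_fin_four_pow_eq_one : ∀ s : Equiv.Perm (Fin 4), (∃ i, s i = i) →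
    s ^ 2 = 1 ∨ s ^ 3 = 1 := by decide

theorem perm_fin_four_sq_eq_one : ∀ s : Equiv.Perm (Fin 4), Equiv.Perm.sign s = 1 →
    (∀ i, s i ≠ i) → s ^ 2 = 1 := by decide

theorem perm_fin_four_card_derangements : (Finset.univ.filter fun s : Equiv.Perm (Fin 4) =>
    Equiv.Perm.sign s = 1 ∧ ∀ i, s i ≠ i).card = 3 := by decide

theorem perm_fin_four_exists_mul : ∀ s : Equiv.Perm (Fin 4), Equiv.Perm.sign s = 1 →
    ∃ t : Equiv.Perm (Fin 4), Equiv.Perm.sign t = 1 ∧ (∃ i, t i = i) ∧ ∃ i, (s * t⁻¹) i = i := by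
  decide

/-- The action on the cosets of a subgroup of index four, as a homomorphism to `S₄`. -/
theorem exists_hom_perm_fin_four {G : Type*} [Group G] [Finite G] (A : Subgroup G)
    (hA : A.index = 4) : ∃ f : G →* Equiv.Perm (Fin 4), f.ker ≤ A ∧ (∀ a ∈ A, ∃ i, f a i = i) ∧
      ∀ t, (∃ i, f t i = i) → ∃ (q : G ⧸ A) (a : G), a ∈ A ∧ t = q.out * a * q.out⁻¹ := by
  let e : (G ⧸ A) ≃ Fin 4 := Finite.equivFinOfCardEq hA
  let f : G →* Equiv.Perm (Fin 4) :=
    e.permCongrHom.toMonoidHom.comp (MulAction.toPermHom G (G ⧸ A))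
  have hf : ∀ t q, f t (e q) = e (t • q) := fun t q => by
    simp [f, Equiv.permCongrHom]
  refine ⟨f, fun t ht => ?_, fun a ha => ⟨e (1 : G), ?_⟩, ?_⟩
  · have h1 := hf t (1 : G)
    rw [MonoidHom.mem_ker.1 ht, Equiv.Perm.one_apply, e.injective.eq_iff,
      MulAction.Quotient.smul_mk, smul_eq_mul, mul_one, QuotientGroup.eq] at h1
    simpa using h1
  · rw [hf, e.injective.eq_iff, MulAction.Quotient.smul_mk, smul_eq_mul, mul_one, QuotientGroup.eq]
    simpa using ha
  · rintro t ⟨i, hi⟩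
    obtain ⟨q, rfl⟩ := e.surjective i
    rw [hf, e.injective.eq_iff] at hi
    refine ⟨q, q.out⁻¹ * t * q.out, ?_, by group⟩
    have h2 : ((t * q.out : G) : G ⧸ A) = (q.out : G) := by
      rw [← smul_eq_mul, ← MulAction.Quotient.smul_mk, QuotientGroup.out_eq', hi]
    rw [mul_assoc, ← QuotientGroup.eq, h2]

/-- The abelian group A centralizes the kernel, hence so do its conjugates, which contain every
element acting with a fixed point. Every even permutation is a product of two even ones with fixed
points, so these elements generate G. -/
theorem ker_le_center_of_range_eq_alternatingGroup {G : Type*} [Group G] (A : Subgroup G)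
    [IsCyclic A] (f : G →* Equiv.Perm (Fin 4)) (hf : f.range = alternatingGroup (Fin 4))
    (hK : f.ker ≤ A) (hfix : ∀ t, (∃ i, f t i = i) →
      ∃ (q : G ⧸ A) (a : G), a ∈ A ∧ t = q.out * a * q.out⁻¹) :
    f.ker ≤ Subgroup.center G := by
  have hA : IsMulCommutative A := IsCyclic.isMulCommutative
  have hAC : A ≤ Subgroup.centralizer (f.ker : Set G) := fun a ha z hz =>
    congrArg Subtype.val (mul_comm' (⟨z, hK hz⟩ : A) ⟨a, ha⟩)
  have hfC : ∀ t, (∃ i, f t i = i) → t ∈ Subgroup.centralizer (f.ker : Set G) := by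
    intro t ht
    obtain ⟨q, a, ha, rfl⟩ := hfix t ht
    exact (inferInstance : (Subgroup.centralizer (f.ker : Set G)).Normal).conj_mem a (hAC ha) _
  intro z hz
  refine Subgroup.mem_center_iff.2 fun g => ?_
  have hg : f g ∈ alternatingGroup (Fin 4) := hf ▸ ⟨g, rfl⟩
  obtain ⟨t, ht, hti, hgt⟩ := perm_fin_four_exists_mul (f g) (Equiv.Perm.mem_alternatingGroup.1 hg)
  obtain ⟨t, rfl⟩ : t ∈ f.range := hf ▸ Equiv.Perm.mem_alternatingGroup.2 ht
  have h1 := hfC (g * t⁻¹) (by simpa using hgt)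
  have h2 := mul_mem h1 (hfC t hti)
  rw [inv_mul_cancel_right] at h2
  exact (h2 z hz).symm

theorem orderOf_le_two_mul_orderOf_sq {G : Type*} [Group G] [Finite G] (y : G) :
    orderOf y ≤ 2 * orderOf (y ^ 2) := by
  refine Nat.le_of_dvd (Nat.mul_pos two_pos (orderOf_pos _)) (orderOf_dvd_of_pow_eq_one ?_)
  rw [pow_mul, pow_orderOf_eq_one]

theorem sum_orderOf_coset_le_two_mul_sq {G : Type*} [Group G] [Finite G] (K : Subgroup G)
    [K.Normal] [Fintype K] (z : G) (hz : z ^ 2 ∈ K) :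
    ∑ u : K, orderOf (z * u) ≤ 2 * Nat.card K ^ 2 := by
  have h : ∀ u ∈ (Finset.univ : Finset K), orderOf (z * u) ≤ 2 * Nat.card K := by
    intro u _
    refine (orderOf_le_two_mul_orderOf_sq _).trans (Nat.mul_le_mul_left 2 ?_)
    have hm : (z * u) ^ 2 ∈ K := by
      rw [← QuotientGroup.eq_one_iff, QuotientGroup.mk_pow, mk_mul_coe, ← QuotientGroup.mk_pow,
        QuotientGroup.eq_one_iff]
      exact hz
    exact Nat.le_of_dvd Nat.card_pos (Subgroup.orderOf_dvd_natCard K hm)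
  refine (Finset.sum_le_card_nsmul _ _ _ h).trans ?_
  rw [Finset.card_univ, ← Nat.card_eq_fintype_card, smul_eq_mul]
  exact le_of_eq (by ring)

/-- For K central of odd order, (zu)² = z²u² and u ↦ z²u² permutes K. This is the sharper bound,
needed when |K| is odd. -/
theorem sum_orderOf_coset_le_two_mul_of_coprime {G : Type*} [Group G] [Finite G] (K : Subgroup G)
    [Fintype K] (hK : K ≤ Subgroup.center G) (hcop : (Nat.card K).Coprime 2) (z : G)
    (hz : z ^ 2 ∈ K) : ∑ u : K, orderOf (z * u) ≤ 2 * sumOrders K := by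
  rw [sumOrders, Finset.mul_sum, ← Equiv.sum_comp ((powCoprime hcop).trans
    (Equiv.mulLeft (⟨z ^ 2, hz⟩ : K))) fun u : K => 2 * orderOf u]
  refine Finset.sum_le_sum fun u _ => (orderOf_le_two_mul_orderOf_sq _).trans_eq ?_
  have : Commute z u := Subgroup.mem_center_iff.1 (hK u.2) z
  rw [this.mul_pow, ← Subgroup.orderOf_coe]
  rfl

theorem sum_le_sum_of_forall_exists {ι κ : Type*} (s : Finset ι) (t : Finset κ) (f : ι → ℕ)
    (g : κ → ι) (h : ∀ i ∈ s, ∃ j ∈ t, g j = i) : ∑ i ∈ s, f i ≤ ∑ j ∈ t, f (g j) := by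
  classical
  exact (Finset.sum_le_sum_of_subset fun i hi => Finset.mem_image.2 (h i hi)).trans
    (Finset.sum_image_le_of_nonneg fun _ _ => Nat.zero_le _)

theorem sum_filter_mem_eq_sumOrders {G : Type*} [Group G] [Fintype G] (K : Subgroup G)
    [Fintype K] [DecidablePred (· ∈ K)] : ∑ g with g ∈ K, orderOf g = sumOrders K := by
  rw [Finset.sum_subtype (p := (· ∈ K)) _ (by simp)]
  exact Finset.sum_congr rfl fun u _ => Subgroup.orderOf_coe u

/-- The count of element orders in a central extension of `A₄` by a cyclic group. -/
theorem sumOrders_add_le {G : Type*} [Group G] [Fintype G] (A : Subgroup G)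
    [IsCyclic A] (hA : A.index = 4) (f : G →* Equiv.Perm (Fin 4))
    (hf : f.range = alternatingGroup (Fin 4))
    (hK : f.ker ≤ A) (hfix : ∀ t, (∃ i, f t i = i) →
      ∃ (q : G ⧸ A) (a : G), a ∈ A ∧ t = q.out * a * q.out⁻¹) [Fintype f.ker] (B : ℕ)
    (hB : ∀ z : G, z ^ 2 ∈ f.ker → ∑ u : f.ker, orderOf (z * u) ≤ B) :
    sumOrders G + 3 * cyclicOrdSum (Nat.card f.ker) ≤ 3 * B + 4 * cyclicOrdSum (Nat.card A) := by
  classical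
  have hKc : IsCyclic f.ker := isCyclic_of_injective _ (Subgroup.inclusion_injective hK)
  let T : Finset A := Finset.univ.filter fun a => (a : G) ∉ f.ker
  have h1 : ∑ g with f g = 1, orderOf g = cyclicOrdSum (Nat.card f.ker) := by
    rw [← sumOrders_eq_of_isCyclic, ← sum_filter_mem_eq_sumOrders]
    simp only [MonoidHom.mem_ker]
  have h2 : ∑ a ∈ T, orderOf (a : G) + cyclicOrdSum (Nat.card f.ker) =
      cyclicOrdSum (Nat.card A) := by
    rw [← sumOrders_eq_of_isCyclic (G := A), sumOrders,
      ← Finset.sum_filter_not_add_sum_filter Finset.univ (fun a : A => (a : G) ∈ f.ker),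
      ← Nat.card_congr (Subgroup.subgroupOfEquivOfLe hK).toEquiv,
      ← sumOrders_eq_of_isCyclic (G := f.ker.subgroupOf A), ← sum_filter_mem_eq_sumOrders]
    simp only [Subgroup.orderOf_coe, T, Subgroup.mem_subgroupOf]
  -- These elements are conjugates of elements of A outside the kernel, one conjugating
  -- representative for each of the four cosets.
  have h3 : ∑ g with f g ≠ 1 ∧ ∃ i, f g i = i, orderOf g ≤ 4 * ∑ a ∈ T, orderOf (a : G) := by
    refine (sum_le_sum_of_forall_exists _ ((Finset.univ : Finset (G ⧸ A)) ×ˢ T) _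
      (fun x => x.1.out * (x.2 : G) * x.1.out⁻¹) fun g hg => ?_).trans ?_
    · obtain ⟨hg1, hg2⟩ := (Finset.mem_filter.1 hg).2
      obtain ⟨q, a, ha, rfl⟩ := hfix g hg2
      refine ⟨(q, ⟨a, ha⟩), ?_, rfl⟩
      simp only [T, Finset.mem_product, Finset.mem_univ, true_and, Finset.mem_filter]
      intro h
      exact hg1 (by simp [MonoidHom.mem_ker.1 h])
    · rw [Finset.sum_product]
      have : ∀ (q : G ⧸ A) (a : A), orderOf (q.out * (a : G) * q.out⁻¹) = orderOf (a : G) :=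
        fun q a => orderOf_injective (MulAut.conj q.out).toMonoidHom (MulAut.conj _).injective _
      simp only [this]
      rw [Finset.sum_const, Finset.card_univ, ← Nat.card_eq_fintype_card, smul_eq_mul]
      exact le_of_eq (congrArg (· * _) hA)
  -- The fixed-point-free elements lie over the three double transpositions, each giving one coset
  -- of the kernel.
  have h4 : ∑ g with ∀ i, f g i ≠ i, orderOf g ≤ 3 * B := by
    rw [← Finset.sum_fiberwise_of_maps_to (t := Finset.univ.filter fun s : Equiv.Perm (Fin 4) =>
        Equiv.Perm.sign s = 1 ∧ ∀ i, s i ≠ i) (g := f)]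
    · rw [← perm_fin_four_card_derangements, ← smul_eq_mul]
      refine Finset.sum_le_card_nsmul _ _ _ fun s hs => ?_
      obtain ⟨hs1, hs2⟩ := (Finset.mem_filter.1 hs).2
      obtain ⟨z, rfl⟩ : s ∈ f.range := hf ▸ Equiv.Perm.mem_alternatingGroup.2 hs1
      refine (sum_le_sum_of_forall_exists _ (Finset.univ : Finset f.ker) _
        (fun u => z * u) fun g hg => ?_).trans (hB z ?_)
      · refine ⟨⟨z⁻¹ * g, ?_⟩, Finset.mem_univ _, by simp⟩
        rw [MonoidHom.mem_ker, map_mul, map_inv, (Finset.mem_filter.1 hg).2, inv_mul_cancel]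
      · rw [MonoidHom.mem_ker, map_pow, perm_fin_four_sq_eq_one _ hs1 hs2]
    · intro g hg
      refine Finset.mem_filter.2 ⟨Finset.mem_univ _, ?_, (Finset.mem_filter.1 hg).2⟩
      exact Equiv.Perm.mem_alternatingGroup.1 (hf ▸ ⟨g, rfl⟩)
  have h5 : sumOrders G = ∑ g with f g = 1, orderOf g +
      (∑ g with f g ≠ 1 ∧ ∃ i, f g i = i, orderOf g + ∑ g with ∀ i, f g i ≠ i, orderOf g) := by
    rw [sumOrders, ← Finset.sum_filter_add_sum_filter_not Finset.univ (fun g => f g = 1),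
      ← Finset.sum_filter_add_sum_filter_not (Finset.univ.filter fun g => ¬ f g = 1)
        (fun g => ∃ i, f g i = i), Finset.filter_filter, Finset.filter_filter]
    congr 3
    ext g
    simp only [Finset.mem_filter, Finset.mem_univ, true_and, not_exists, ne_eq]
    exact ⟨fun h => h.2, fun h => ⟨fun h1 => h 0 (by simp [h1]), h⟩⟩
  omega

/-- Here k = 2^i·3^j stands for |K| and S for ψ(G). The odd bound leaves only j = 0 when i = 0; the
crude bound with 2k² already fails for i > 0. -/
theorem eq_one_of_cyclicOrdSum_le {k S : ℕ} (hk : k ≠ 0) (hr : ∀ r, r.Prime → r ∣ k → r ≤ 4)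
    (h1 : 31 * cyclicOrdSum (12 * k) ≤ 77 * S)
    (h2 : S + 3 * cyclicOrdSum k ≤ 3 * (2 * k ^ 2) + 4 * cyclicOrdSum (3 * k))
    (h3 : k.Coprime 2 → S + 3 * cyclicOrdSum k ≤ 3 * (2 * cyclicOrdSum k) +
      4 * cyclicOrdSum (3 * k)) : k = 1 := by
  obtain ⟨i, m, hm, rfl⟩ := Nat.exists_eq_pow_mul_and_not_dvd hk 2 (by norm_num)
  have hm0 : m ≠ 0 := by rintro rfl; simp at hm
  obtain ⟨j, l, hl, rfl⟩ := Nat.exists_eq_pow_mul_and_not_dvd hm0 3 (by norm_num)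
  obtain rfl : l = 1 := by
    by_contra h
    obtain ⟨r, hrp, hrl⟩ := Nat.exists_prime_and_dvd h
    have h4 := hr r hrp ((hrl.mul_left _).mul_left _)
    have h5 := hrp.two_le
    interval_cases r
    · exact hm (hrl.mul_left _)
    · exact hl hrl
    · norm_num at hrp
  rw [mul_one] at *
  have hc : ∀ a b, cyclicOrdSum (2 ^ a * 3 ^ b) = cyclicOrdSum (2 ^ a) * cyclicOrdSum (3 ^ b) :=
    fun a b => cyclicOrdSum_mul (Nat.Coprime.pow a b (by norm_num))
  rw [show 12 * (2 ^ i * 3 ^ j) = 2 ^ (i + 2) * 3 ^ (j + 1) by ring, hc] at h1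
  rw [show 3 * (2 ^ i * 3 ^ j) = 2 ^ i * 3 ^ (j + 1) by ring, hc, hc] at h2 h3
  have a0 := cyclicOrdSum_prime_pow Nat.prime_two i
  have a2 := cyclicOrdSum_prime_pow Nat.prime_two (i + 2)
  have b0 := cyclicOrdSum_prime_pow Nat.prime_three j
  have b1 := cyclicOrdSum_prime_pow Nat.prime_three (j + 1)
  -- The closed forms give linear recurrences, so everything becomes polynomial in ψ(2^i) and
  -- ψ(3^j).
  have ea : cyclicOrdSum (2 ^ (i + 2)) + 5 = 16 * cyclicOrdSum (2 ^ i) := by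
    rw [pow_add] at a2 ⊢; ring_nf at a0 a2 ⊢; omega
  have eb : cyclicOrdSum (3 ^ (j + 1)) + 2 = 9 * cyclicOrdSum (3 ^ j) := by
    rw [pow_add] at b1 ⊢; ring_nf at b0 b1 ⊢; omega
  have hβ : 0 < cyclicOrdSum (3 ^ j) := cyclicOrdSum_pos (by positivity)
  generalize cyclicOrdSum (2 ^ (i + 2)) = α₂ at *
  generalize cyclicOrdSum (3 ^ (j + 1)) = β₁ at *
  rcases Nat.eq_zero_or_pos i with rfl | hi
  · have h3' := h3 (by simpa using Nat.Coprime.pow_left j (by norm_num : Nat.Coprime 3 2))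
    simp only [pow_zero, cyclicOrdSum_one, one_mul] at h3' ea ⊢
    obtain rfl : α₂ = 11 := by omega
    have hb : cyclicOrdSum (3 ^ j) ≤ 1 := by omega
    rcases Nat.eq_zero_or_pos j with rfl | hj
    · rfl
    · have : 3 ^ 1 ≤ 3 ^ j := Nat.pow_le_pow_right (by norm_num) hj
      nlinarith
  · exfalso
    have hα : 3 ≤ cyclicOrdSum (2 ^ i) := by
      have : 2 ^ 1 ≤ 2 ^ i := Nat.pow_le_pow_right (by norm_num) hi
      nlinarith
    generalize cyclicOrdSum (2 ^ i) = α at *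
    generalize cyclicOrdSum (3 ^ j) = β at *
    -- Multiplying 3α = 2·4^i + 1 by 4β = 3·9^j + 1 eliminates k².
    have hk2 : 6 * (2 ^ i * 3 ^ j) ^ 2 + 4 * β + 3 * α = 12 * α * β + 1 := by
      have : (3 * α) * (4 * β) = (2 * (2 ^ i) ^ 2 + 1) * (3 * (3 ^ j) ^ 2 + 1) := by
        rw [← a0, ← b0]
      nlinarith
    generalize (2 ^ i * 3 ^ j) ^ 2 = k₂ at *
    clear a0 a2 b0 b1 h3 hc hr hk hm hm0 hl hi
    obtain ⟨a, rfl⟩ := Nat.exists_eq_add_of_le hα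
    obtain ⟨b, rfl⟩ := Nat.exists_eq_add_of_le hβ
    obtain rfl : α₂ = 16 * a + 43 := by omega
    obtain rfl : β₁ = 9 * b + 7 := by omega
    nlinarith [Nat.zero_le (a * b)]

/-- A generator of A fixes a coset, so its image in S₄ has order 1, 2 or 3 and the kernel has index
4, 8 or 12. The first two give a 2-group over a cyclic kernel; the last gives image A₄, where the
count forces a trivial kernel. -/
theorem isSupersolvable_or_mulEquiv_of_index_four {G : Type*} [Group G] [Fintype G]
    (A : Subgroup G) [IsCyclic A] (hA : A.index = 4)
    (hr : ∀ r, r.Prime → r ∣ Nat.card G → r ≤ 4)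
    (hψ : 31 * cyclicOrdSum (Nat.card G) ≤ 77 * sumOrders G) :
    IsSupersolvable G ∨ Nonempty (G ≃* alternatingGroup (Fin 4)) ∧
      77 * sumOrders G ≤ 31 * cyclicOrdSum (Nat.card G) := by
  obtain ⟨f, hK, hAfix, hfix⟩ := exists_hom_perm_fin_four A hA
  have hKc : IsCyclic f.ker := isCyclic_of_injective _ (Subgroup.inclusion_injective hK)
  obtain ⟨x, rfl⟩ := A.isCyclic_iff_exists_zpowers_eq_top.1 inferInstance
  have hi : orderOf (f x) * 4 = f.ker.index := by
    rw [← Subgroup.relIndex_mul_index hK, hA, Subgroup.relIndex_ker, MonoidHom.map_zpowers,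
      Nat.card_zpowers]
  have hss : ∀ e, f.ker.index = 2 ^ e → IsSupersolvable G := fun e he => by
    have : IsPGroup 2 (G ⧸ f.ker) := IsPGroup.of_card he
    exact .of_quotient f.ker this.isSupersolvable
  have h3 : orderOf (f x) = 1 ∨ orderOf (f x) = 2 ∨ orderOf (f x) = 3 := by
    rcases perm_fin_four_pow_eq_one (f x) (hAfix x (Subgroup.mem_zpowers x)) with h | h
    · have := (Nat.dvd_prime Nat.prime_two).1 (orderOf_dvd_of_pow_eq_one h)
      omega
    · have := (Nat.dvd_prime Nat.prime_three).1 (orderOf_dvd_of_pow_eq_one h)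
      omega
  rcases h3 with h | h | h
  · exact .inl (hss 2 (by omega))
  · exact .inl (hss 3 (by omega))
  right
  have hrange : f.range = alternatingGroup (Fin 4) := by
    apply Equiv.Perm.eq_alternatingGroup_of_index_eq_two
    have h1 := f.range.card_mul_index
    rw [← Subgroup.index_ker, ← hi, h, Nat.card_perm, Nat.card_fin] at h1
    norm_num [Nat.factorial] at h1
    omega
  have hcenter := ker_le_center_of_range_eq_alternatingGroup _ f hrange hK hfix
  have := Fintype.ofFinite f.ker
  have hcard : Nat.card G = 12 * Nat.card f.ker := by
    rw [← f.ker.card_mul_index, ← hi, h]; ring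
  have hcardA : Nat.card (Subgroup.zpowers x) = 3 * Nat.card f.ker := by
    have := (Subgroup.zpowers x).card_mul_index
    rw [hA] at this
    omega
  have hk0 : Nat.card f.ker ≠ 0 := Nat.card_pos.ne'
  have hsum := sumOrders_add_le _ hA f hrange hK hfix
  rw [hcardA] at hsum
  have hk : Nat.card f.ker = 1 := by
    refine eq_one_of_cyclicOrdSum_le (S := sumOrders G) hk0
      (fun r hrp hrk => hr r hrp (hcard ▸ hrk.mul_left _))
      (hcard ▸ hψ) (hsum _ (sum_orderOf_coset_le_two_mul_sq f.ker)) fun hcop => ?_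
    have := hsum _ (sum_orderOf_coset_le_two_mul_of_coprime f.ker hcenter hcop)
    rwa [sumOrders_eq_of_isCyclic (G := f.ker)] at this
  have hcyc : cyclicOrdSum 3 = 7 ∧ cyclicOrdSum 12 = 77 := by decide
  refine ⟨⟨?_⟩, ?_⟩
  · have hinj : Function.Injective f := (MonoidHom.ker_eq_bot_iff f).1 (Subgroup.eq_bot_of_card_eq _ hk)
    exact (MonoidHom.ofInjective hinj).trans (MulEquiv.subgroupCongr hrange)
  · have h1 := hsum _ (sum_orderOf_coset_le_two_mul_sq f.ker)
    rw [hcard]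
    rw [hk] at h1 ⊢
    simp only [mul_one, hcyc.1, hcyc.2, cyclicOrdSum_one] at h1 ⊢
    omega

/-! ### From large ψ to a cyclic subgroup of small index. -/

/-- A cyclic subgroup of index smaller than the prime `p` yields a cyclic normal Sylow
`p`-subgroup. -/
theorem exists_normal_isCyclic_sylow {G : Type*} [Group G] [Finite G] {p : ℕ} [Fact p.Prime]
    (A : Subgroup G) [IsCyclic A] (hA : A.index < p) :
    ∃ P : Sylow p G, (P : Subgroup G).Normal ∧ IsCyclic (P : Subgroup G) := by
  have hp : p.Prime := Fact.out
  obtain ⟨x, rfl⟩ := A.isCyclic_iff_exists_zpowers_eq_top.1 inferInstance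
  have hcard := (Subgroup.zpowers x).card_mul_index
  have hi0 : (Subgroup.zpowers x).index ≠ 0 := Subgroup.index_ne_zero_of_finite
  have hnd : ¬ p ∣ (Subgroup.zpowers x).index := fun h =>
    absurd (Nat.le_of_dvd (Nat.pos_of_ne_zero hi0) h) (by omega)
  rw [Nat.card_zpowers] at hcard
  have hx0 := orderOf_pos x
  have hfac : (Nat.card G).factorization p = (orderOf x).factorization p := by
    rw [← hcard, Nat.factorization_mul hx0.ne' hi0]
    simp [Nat.factorization_eq_zero_of_not_dvd hnd]
  -- The index is prime to p, so the p-part of ⟨x⟩ is a full Sylow subgroup; ⟨x⟩ centralizes it.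
  set y := x ^ (orderOf x / p ^ (orderOf x).factorization p) with hy
  have hyo : orderOf y = p ^ (orderOf x).factorization p :=
    orderOf_pow_orderOf_div hx0.ne' (Nat.ordProj_dvd _ _)
  let P : Sylow p G := Sylow.ofCard (Subgroup.zpowers y) (by rw [Nat.card_zpowers, hyo, hfac])
  have hP : (P : Subgroup G) = Subgroup.zpowers y := Sylow.coe_ofCard _ _
  refine ⟨P, P.normal_of_index_lt (A := Subgroup.zpowers x) ?_ hA, by rw [hP]; infer_instance⟩
  have hc : Subgroup.zpowers x ≤ Subgroup.centralizer (P : Set G) := by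
    rw [Subgroup.zpowers_le]
    intro z hz
    have hz' : z ∈ Subgroup.zpowers y := hP ▸ hz
    obtain ⟨e, rfl⟩ := hz'
    exact (((Commute.refl x).pow_left _).zpow_left e).eq
  exact hc.trans (Subgroup.centralizer_le_normalizer _)

/-- N is the largest prime factor, replaced by 4 when that is at most 3: the telescoped bound starts
at 4. -/
theorem exists_four_le_bound_prime_factors (n : ℕ) (hn : n ≠ 0) :
    ∃ N, 4 ≤ N ∧ (∀ r, r.Prime → r ∣ n → r ≤ N) ∧ (N = 4 ∨ N.Prime ∧ N ∣ n) := by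
  by_cases h : ∀ r, r.Prime → r ∣ n → r ≤ 4
  · exact ⟨4, le_rfl, h, .inl rfl⟩
  push Not at h
  obtain ⟨r, hr, hrn, hr4⟩ := h
  have hne : n.primeFactors.Nonempty := ⟨r, Nat.mem_primeFactors.2 ⟨hr, hrn, hn⟩⟩
  have hm := Nat.mem_primeFactors.1 (n.primeFactors.max'_mem hne)
  have hle : ∀ s, s.Prime → s ∣ n → s ≤ n.primeFactors.max' hne := fun s hs hsn =>
    Finset.le_max' _ _ (Nat.mem_primeFactors.2 ⟨hs, hsn, hn⟩)
  exact ⟨_, hr4.le.trans (hle r hr hrn), hle, .inr ⟨hm.1, hm.2.1⟩⟩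

/-- If `ψ(G)` is large, then `G` has an element whose cyclic subgroup has small index. -/
theorem exists_index_zpowers_le {G : Type*} [Group G] [Fintype G] {N : ℕ} (hN : 4 ≤ N)
    (hr : ∀ r, r.Prime → r ∣ Nat.card G → r ≤ N)
    (hψ : 31 * cyclicOrdSum (Nat.card G) ≤ 77 * sumOrders G) :
    ∃ x : G, (Subgroup.zpowers x).index ≤ N := by
  obtain ⟨x, -, hx⟩ :=
    Finset.exists_max_image (Finset.univ : Finset G) orderOf ⟨1, Finset.mem_univ _⟩
  refine ⟨x, Nat.le_of_lt_succ ?_⟩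
  have h1 : sumOrders G ≤ Nat.card G * orderOf x := by
    refine (Finset.sum_le_card_nsmul _ _ _ hx).trans ?_
    rw [Finset.card_univ, ← Nat.card_eq_fintype_card, smul_eq_mul]
  have h2 := cyclicOrdSum_lower_bound N hN (Nat.card G) Nat.card_pos.ne' hr
  have h3 := (Subgroup.zpowers x).card_mul_index
  rw [Nat.card_zpowers] at h3
  have hn : 0 < Nat.card G := Nat.card_pos
  have hc : 0 < Nat.card G * orderOf x := Nat.mul_pos hn (orderOf_pos x)
  -- The constants are 155 = 31·5 and 154 = 77·2; the gap makes the index strictly less than N + 1.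
  have h4 : 155 * (Nat.card G * orderOf x) * (Subgroup.zpowers x).index ≤
      154 * (Nat.card G * orderOf x) * (N + 1) := by
    calc _ = 31 * (5 * (Nat.card G * (orderOf x * (Subgroup.zpowers x).index))) := by ring
      _ = 31 * (5 * Nat.card G ^ 2) := by rw [h3, sq]
      _ ≤ 31 * (2 * (N + 1) * cyclicOrdSum (Nat.card G)) := Nat.mul_le_mul_left _ h2
      _ = 2 * (N + 1) * (31 * cyclicOrdSum (Nat.card G)) := by ring
      _ ≤ 2 * (N + 1) * (77 * (Nat.card G * orderOf x)) :=
        Nat.mul_le_mul_left _ (hψ.trans (Nat.mul_le_mul_left _ h1))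
      _ = _ := by ring
  by_contra! h
  nlinarith [Nat.mul_le_mul_left (155 * (Nat.card G * orderOf x)) h]

/-! ### Induction on the order and conclusion. -/

theorem nonempty_mulEquiv_cyclicGroupOfOrder (C : Type*) [Group C] [Finite C] [IsCyclic C] :
    Nonempty (C ≃* CyclicGroupOfOrder (Nat.card C)) :=
  ⟨(zmodCyclicMulEquiv inferInstance).symm⟩

theorem cyclicGroupOfOrder_mul {m n : ℕ} (h : m.Coprime n) :
    Nonempty (CyclicGroupOfOrder m × CyclicGroupOfOrder n ≃* CyclicGroupOfOrder (m * n)) :=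
  ⟨((MulEquiv.prodMultiplicative _ _).symm.trans
    (ZMod.chineseRemainder h).symm.toAddEquiv.toMultiplicative)⟩

/-- An inequality is assumed because it, unlike equality, passes to G/P. The reverse inequality is
carried in the conclusion so that equality in G/P can be lifted to G. -/
theorem isSupersolvable_or_mulEquiv {G : Type*} [Group G] [Fintype G]
    (hψ : 31 * cyclicOrdSum (Nat.card G) ≤ 77 * sumOrders G) :
    IsSupersolvable G ∨ (∃ m : ℕ, 0 < m ∧ Nat.Coprime 6 m ∧
      Nonempty (G ≃* alternatingGroup (Fin 4) × CyclicGroupOfOrder m)) ∧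
      77 * sumOrders G ≤ 31 * cyclicOrdSum (Nat.card G) := by
  induction hn : Nat.card G using Nat.strong_induction_on generalizing G with
  | _ n ih =>
  subst hn
  obtain ⟨N, hN4, hNr, hN⟩ :=
    exists_four_le_bound_prime_factors (Nat.card G) Nat.card_pos.ne'
  obtain ⟨x, hx⟩ := exists_index_zpowers_le hN4 hNr hψ
  have hi0 : (Subgroup.zpowers x).index ≠ 0 := Subgroup.index_ne_zero_of_finite
  by_cases hprime : (Subgroup.zpowers x).index.Prime
  · exact .inl (.of_isCyclic_of_index_prime hprime _ rfl)
  rcases hN with rfl | ⟨hNp, hNd⟩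
  · by_cases h4 : (Subgroup.zpowers x).index = 4
    · refine (isSupersolvable_or_mulEquiv_of_index_four _ h4 hNr hψ).imp_right
        fun ⟨⟨e⟩, h⟩ => ⟨⟨1, one_pos, by norm_num, ⟨?_⟩⟩, h⟩
      have : Unique (CyclicGroupOfOrder 1) := inferInstanceAs (Unique (ZMod 1))
      exact e.trans MulEquiv.prodUnique.symm
    · have h1 : (Subgroup.zpowers x).index = 1 := by
        generalize (Subgroup.zpowers x).index = i at *
        interval_cases i <;> revert hprime <;> try norm_num
        all_goals omega
      have htop := Subgroup.index_eq_one.1 h1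
      have : IsCyclic G := isCyclic_iff_exists_zpowers_eq_top.2 ⟨x, htop⟩
      exact .inl (.of_isCyclic G)
  have : Fact N.Prime := ⟨hNp⟩
  have hlt : (Subgroup.zpowers x).index < N :=
    lt_of_le_of_ne hx fun h => hprime (h ▸ hNp)
  obtain ⟨P, hPn, hPc⟩ := exists_normal_isCyclic_sylow (p := N) _ hlt
  obtain ⟨k, hk⟩ := (IsPGroup.iff_card).1 P.isPGroup'
  have hcop : (Nat.card P).Coprime (P : Subgroup G).index := P.card_coprime_index
  have hPd : N ∣ Nat.card P := P.dvd_card_of_dvd_card hNd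
  generalize (P : Subgroup G) = Q at *
  have := Fintype.ofFinite (G ⧸ Q)
  have hcard : Nat.card Q * Nat.card (G ⧸ Q) = Nat.card G := Q.card_mul_index
  obtain ⟨hle, heq⟩ := sumOrders_le_mul_sumOrders_quotient hNp Q hPc hk hcop
  have hQ0 : 0 < cyclicOrdSum (Nat.card Q) := cyclicOrdSum_pos Nat.card_pos.ne'
  have hmul : cyclicOrdSum (Nat.card G) = cyclicOrdSum (Nat.card Q) *
      cyclicOrdSum (Nat.card (G ⧸ Q)) := by
    rw [← hcard]; exact cyclicOrdSum_mul hcop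
  have hψ' : 31 * cyclicOrdSum (Nat.card (G ⧸ Q)) ≤ 77 * sumOrders (G ⧸ Q) := by
    refine Nat.le_of_mul_le_mul_left (c := cyclicOrdSum (Nat.card Q)) ?_ hQ0
    rw [hmul] at hψ
    linarith
  have hQ1 : 1 < Nat.card Q := hNp.one_lt.trans_le (Nat.le_of_dvd Nat.card_pos hPd)
  have hlt' : Nat.card (G ⧸ Q) < Nat.card G := by
    rw [← hcard]
    exact lt_mul_of_one_lt_left Nat.card_pos hQ1
  rcases ih _ hlt' hψ' rfl with h | ⟨⟨m, hm0, hm, ⟨e⟩⟩, h⟩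
  · exact .inl (.of_quotient Q h)
  have hge : 77 * sumOrders G ≤ 31 * cyclicOrdSum (Nat.card G) := by
    rw [hmul]
    have := Nat.mul_le_mul_left (cyclicOrdSum (Nat.card Q)) h
    linarith
  refine .inr ⟨⟨m * Nat.card Q, Nat.mul_pos hm0 Nat.card_pos, ?_, ?_⟩, hge⟩
  all_goals
    have hm' : Nat.card (G ⧸ Q) = 12 * m := by
      rw [Nat.card_congr e.toEquiv, Nat.card_prod, nat_card_alternatingGroup]
      rw [Nat.card_fin]
      exact congrArg (12 * ·) (Nat.card_zmod m)
    have hcop' : (Nat.card Q).Coprime (12 * m) := hm' ▸ hcop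
  · exact hm.mul_right (hcop'.coprime_dvd_right ⟨2 * m, by ring⟩).symm
  -- Equality in the quotient bound forces Q to be central, hence a direct factor.
  · have heq' : sumOrders G = cyclicOrdSum (Nat.card Q) * sumOrders (G ⧸ Q) := by
      refine le_antisymm hle ?_
      rw [hmul] at hψ
      have := Nat.mul_le_mul_left (cyclicOrdSum (Nat.card Q)) h
      linarith
    obtain ⟨e₁⟩ := nonempty_mulEquiv_prod_of_le_center Q (heq heq') hcop
    obtain ⟨e₂⟩ := nonempty_mulEquiv_cyclicGroupOfOrder Q
    obtain ⟨e₃⟩ := cyclicGroupOfOrder_mul (hcop'.coprime_dvd_right (Dvd.intro_left _ rfl)).symm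
    exact ⟨(e₁.trans (e.prodCongr e₂)).trans
      (MulEquiv.prodAssoc.trans ((MulEquiv.refl _).prodCongr e₃))⟩

theorem mainTheorem2 {G : Type*} [Group G] [Fintype G] (n : ℕ) [NeZero n]
    (hn : Fintype.card G = n)
    (hG : ¬ IsSupersolvable G)
    (hψ : (sumOrders G : ℚ) = 31 / 77 * (sumOrders (CyclicGroupOfOrder n) : ℚ)) :
    ∃ m : ℕ, 0 < m ∧ Nat.gcd 6 m = 1 ∧
      Nonempty (G ≃* alternatingGroup (Fin 4) × CyclicGroupOfOrder m) := by
  have hc : sumOrders (CyclicGroupOfOrder n) = cyclicOrdSum (Nat.card G) := by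
    rw [sumOrders_eq_of_isCyclic, Nat.card_eq_fintype_card (α := G), hn]
    exact congrArg cyclicOrdSum (Nat.card_zmod n)
  rw [hc] at hψ
  have h : 31 * cyclicOrdSum (Nat.card G) ≤ 77 * sumOrders G := by
    have : (31 * cyclicOrdSum (Nat.card G) : ℚ) = 77 * sumOrders G := by rw [hψ]; ring
    exact_mod_cast this.le
  rcases isSupersolvable_or_mulEquiv h with h | ⟨h, -⟩
  · exact absurd h hG
  · exact h
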